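/- Let $\mathcal{A}$ and $\mathcal{P}$ be categories with pullbacks and let $\mathcal{D}\dashv\mathcal{C}$ be an adjunction with left adjoint $\mathcal{D}:\mathcal{A}\to\mathcal{P}$ and right adjoint $\mathcal{C}:\mathcal{P}\to\mathcal{A}$, with unit $\eta$. For an object $S$ of $\mathcal{A}$, let $\mathcal{D}_S\dashv\mathcal{C}_S$ denote the sliced adjunction between $\mathcal{A}/S$ and $\mathcal{P}/\mathcal{D}S$: here $\mathcal{D}_S(V\xrightarrow{g}S)=(\mathcal{D}V\xrightarrow{\mathcal{D}g}\mathcal{D}S)$, and $\mathcal{C}_S(X\xrightarrow{\phi}\mathcal{D}S)$ is the pullback of $\mathcal{C}\phi:\mathcal{C}X\to\mathcal{C}\mathcal{D}S$ along $\eta_S:S\to\mathcal{C}\mathcal{D}S$. For a morphism $\sigma:S\to R$ of $\mathcal{A}$, let $\Sigma_\sigma:\mathcal{A}/S\to\mathcal{A}/R$ be composition with $\sigma$ and let $\sigma^*:\mathcal{A}/R\to\mathcal{A}/S$ be its right adjoint, pullback along $\sigma$. A morphism $\sigma:S\to R$ of $\mathcal{A}$ is said to be of Galois descent if 1. $\sigma^*:\mathcal{A}/R\to\mathcal{A}/S$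 is monadic; 2. the counit of $\mathcal{D}_S\dashv\mathcal{C}_S$ is an isomorphism; and 3. for every object $X_\phi=(X\xrightarrow{\phi}\mathcal{D}S)$ of $\mathcal{P}/\mathcal{D}S$, the unit of $\mathcal{D}_S\dashv\mathcal{C}_S$ is an isomorphism at $\sigma^*\Sigma_\sigma\mathcal{C}_SX_\phi$. An object $A_a=(A\xrightarrow{a}R)$ of $\mathcal{A}/R$ is $\sigma$-split if the unit of $\mathcal{D}_S\dashv\mathcal{C}_S$ is an isomorphism at $\sigma^*A_a$; let $\mathrm{Split}_R(\sigma)$ be the full subcategory of $\mathcal{A}/R$ on the $\sigma$-split objects. For a groupoid $\mathbb{G}$ internal to $\mathcal{P}$, with object of objects $G_0$, object of morphisms $G_1$ and domain and codomain maps $d,c:G_1\to G_0$, let $[\mathbb{G},\mathcal{P}]$ be the category of $\mathbb{G}$-objects: its objects are morphisms $p:X\to G_0$ of $\mathcal{P}$ equipped with a unital and associative action $G_1\times_{d,p}X\to X$ that is a morphism over $G_0$, the domain being regarded as an object over $G_0$ through $c$; its morphisms are the equivariant morphisms over $G_0$. **Theorem.** If $\sigma:S\to R$ is a morphism of $\mathcal{A}$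 of Galois descent, then there exists a groupoid $\mathrm{Gal}[\sigma]$ internal to $\mathcal{P}$ and an equivalence of categories $$\mathrm{Split}_R(\sigma)\simeq[\mathrm{Gal}[\sigma],\mathcal{P}].$$ -/

import Mathlib

open CategoryTheory CategoryTheory.Limits

universe v u v₁ v₂ u₁ u₂

noncomputable section

namespace CategoricalGalois

/-- A groupoid internal to a category `P` with pullbacks. Composition is written in diagrammatic
order: it sends a composable pair `(f, g)` with `cod f = dom g` to "`f` followed by `g`".
Associativity is stated on generalised elements `f, g, h : T ⟶ mor`, which by the Yoneda lemma is
the same as the usual diagram on the object of composable triples. -/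
structure InternalGroupoid (P : Type u) [Category.{v} P] [HasPullbacks P] where
  /-- the object of objects -/
  obj : P
  /-- the object of morphisms -/
  mor : P
  /-- domain -/
  dom : mor ⟶ obj
  /-- codomain -/
  cod : mor ⟶ obj
  /-- identities -/
  ident : obj ⟶ mor
  /-- composition -/
  comp : pullback cod dom ⟶ mor
  /-- inverses -/
  inv : mor ⟶ mor
  ident_dom : ident ≫ dom = 𝟙 obj
  ident_cod : ident ≫ cod = 𝟙 obj
  comp_dom : comp ≫ dom = pullback.fst cod dom ≫ dom
  comp_cod : comp ≫ cod = pullback.snd cod dom ≫ cod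
  ident_comp : pullback.lift (dom ≫ ident) (𝟙 mor)
    (by rw [Category.assoc, ident_cod, Category.comp_id, Category.id_comp]) ≫ comp = 𝟙 mor
  comp_ident : pullback.lift (𝟙 mor) (cod ≫ ident)
    (by rw [Category.assoc, ident_dom, Category.comp_id, Category.id_comp]) ≫ comp = 𝟙 mor
  assoc : ∀ {T : P} (f g h : T ⟶ mor) (hfg : f ≫ cod = g ≫ dom) (hgh : g ≫ cod = h ≫ dom),
    pullback.lift (pullback.lift f g hfg ≫ comp) h
        (by rw [Category.assoc, comp_cod, pullback.lift_snd_assoc, hgh]) ≫ comp =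
      pullback.lift f (pullback.lift g h hgh ≫ comp)
        (by rw [Category.assoc, comp_dom, pullback.lift_fst_assoc, hfg]) ≫ comp
  inv_dom : inv ≫ dom = cod
  inv_cod : inv ≫ cod = dom
  comp_inv : pullback.lift (𝟙 mor) inv (by rw [Category.id_comp, inv_dom]) ≫ comp = dom ≫ ident
  inv_comp : pullback.lift inv (𝟙 mor) (by rw [Category.id_comp, inv_cod]) ≫ comp = cod ≫ ident

namespace InternalGroupoid

variable {P : Type u} [Category.{v} P] [HasPullbacks P]

/-- A `G`-object (internal diagram on `G`): an object `X` over the object of objects of `G`,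
together with an action of the morphisms of `G`, which carries `(g, x)` with `anchor x = dom g` to
`g • x` lying over `cod g`. -/
structure GObject (G : InternalGroupoid P) where
  /-- the underlying object -/
  carrier : P
  /-- the structure map to the object of objects -/
  anchor : carrier ⟶ G.obj
  /-- the action -/
  act : pullback G.dom anchor ⟶ carrier
  act_anchor : act ≫ anchor = pullback.fst G.dom anchor ≫ G.cod
  ident_act : pullback.lift (anchor ≫ G.ident) (𝟙 carrier)
    (by rw [Category.assoc, G.ident_dom, Category.comp_id, Category.id_comp]) ≫ act = 𝟙 carrier
  comp_act : ∀ {T : P} (f g : T ⟶ G.mor) (x : T ⟶ carrier) (hfg : f ≫ G.cod = g ≫ G.dom)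
    (hfx : f ≫ G.dom = x ≫ anchor),
    pullback.lift (pullback.lift f g hfg ≫ G.comp) x
        (by rw [Category.assoc, G.comp_dom, pullback.lift_fst_assoc, hfx]) ≫ act =
      pullback.lift g (pullback.lift f x hfx ≫ act)
        (by rw [Category.assoc, act_anchor, pullback.lift_fst_assoc, hfg]) ≫ act

namespace GObject

variable {G : InternalGroupoid P}

/-- A morphism of `G`-objects: an equivariant map over the object of objects. -/
@[ext]
structure Hom (X Y : GObject G) where
  /-- the underlying morphism -/
  hom : X.carrier ⟶ Y.carrier
  hom_anchor : hom ≫ Y.anchor = X.anchor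
  act_hom : X.act ≫ hom = pullback.lift (pullback.fst G.dom X.anchor)
    (pullback.snd G.dom X.anchor ≫ hom)
    (by rw [Category.assoc, hom_anchor, pullback.condition]) ≫ Y.act

/-- The category `[G, P]` of `G`-objects. -/
instance : Category (GObject G) where
  Hom := Hom
  id X :=
    { hom := 𝟙 _
      hom_anchor := Category.id_comp _
      act_hom := by
        rw [Category.comp_id]
        conv_lhs => rw [← Category.id_comp X.act]
        congr 1
        ext <;> simp }
  comp f g :=
    { hom := f.hom ≫ g.hom
      hom_anchor := by rw [Category.assoc, g.hom_anchor, f.hom_anchor]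
      act_hom := by
        rw [← Category.assoc, f.act_hom, Category.assoc, g.act_hom, ← Category.assoc]
        congr 1
        apply pullback.hom_ext
        · rw [Category.assoc, pullback.lift_fst, pullback.lift_fst, pullback.lift_fst]
        · rw [Category.assoc, pullback.lift_snd, pullback.lift_snd_assoc, pullback.lift_snd,
            Category.assoc] }
  id_comp f := Hom.ext (Category.id_comp _)
  comp_id f := Hom.ext (Category.comp_id _)
  assoc f g h := Hom.ext (Category.assoc _ _ _)

end GObject

end InternalGroupoid

variable {A : Type u₁} [Category.{v₁} A] [HasPullbacks A] {P : Type u₂} [Category.{v₂} P]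
  {D : A ⥤ P} {C : P ⥤ A}

/-- The right adjoint `C_S : P/DS ⥤ A/S` of the adjunction sliced at `S`: apply `C`, then pull
back along the unit `S ⟶ CDS`. -/
abbrev slicedRight (adj : D ⊣ C) (S : A) : Over (D.obj S) ⥤ Over S :=
  Over.post C ⋙ Over.pullback (adj.unit.app S)

/-- The adjunction `D_S ⊣ C_S` between `A/S` and `P/DS` obtained by slicing `D ⊣ C` at `S`. -/
abbrev slicedAdj (adj : D ⊣ C) (S : A) :
    (Over.post D : Over S ⥤ Over (D.obj S)) ⊣ slicedRight adj S :=
  Over.postAdjunctionLeft adj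

/-- An object of `A/R` is `σ`-split if the unit of the adjunction sliced at `S` is an isomorphism
at its pullback along `σ : S ⟶ R`. -/
def IsSplit (adj : D ⊣ C) {S R : A} (σ : S ⟶ R) : ObjectProperty (Over R) :=
  fun X => IsIso ((slicedAdj adj S).unit.app ((Over.pullback σ).obj X))

/-- The full subcategory of `A/R` on the `σ`-split objects. -/
abbrev Split (adj : D ⊣ C) {S R : A} (σ : S ⟶ R) :=
  (IsSplit adj σ).FullSubcategory

/-- Morphisms of Galois descent with respect to the adjunction `D ⊣ C`. -/
structure IsGaloisDescent (adj : D ⊣ C) {S R : A} (σ : S ⟶ R) : Prop where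
  monadic : Nonempty (MonadicRightAdjoint (Over.pullback σ))
  isIso_counit : IsIso (slicedAdj adj S).counit
  isIso_unit : ∀ X : Over (D.obj S), IsIso ((slicedAdj adj S).unit.app
    ((Over.pullback σ).obj ((Over.map σ).obj ((slicedRight adj S).obj X))))

end CategoricalGalois

end

/-!
Write `T = σ^* Σ_σ` for the monad on `A/S`. Since `σ^*` is monadic, `A/R` is equivalent to the
category of `T`-algebras, compatibly with the functors to `A/S`; the `σ`-split objects correspond
to the algebras on a trivial object, that is, on a `V` over `S` at which the unit of the sliced
adjunction is invertible (`IsGaloisDescent.isEquivalence_splitComparison`). An algebra on `V` is a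
map `V ×_R S ⟶ V` satisfying the conditions of `IsDescentDatum`.

Because the counit of `D_S ⊣ C_S` is invertible, `D` induces an equivalence between the trivial
objects over `S` and `P/DS`. Three consequences are used: `D` is bijective on maps over `S` into a
trivial object (`IsTrivial.map_injective`, `IsTrivial.exists_map_eq`), every object over `DS` is
the image of a trivial object (`exists_isTrivial_iso`), and `D` preserves products over `S` of
trivial objects (`isPullback_map_of_isTrivial`). The third condition of Galois descent says that
`T` preserves trivial objects. The kernel pair `S ×_R S` is therefore trivial over `S` through both
projections, and `D` preserves all the fibre products `V ×_S (S ×_R S) = V ×_R S` with `V` trivial,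
as well as their iterates. Hence the image of the kernel pair of `σ` under `D` is a groupoid
`Gal[σ]` (`IsGaloisDescent.gal`), and the pairs of a morphism of `Gal[σ]` and an element of `DV`
over its domain form the object `D(V ×_R S)`. A `T`-algebra structure on a trivial `V` is then the
same as an action of `Gal[σ]` on `DV`, which gives the equivalence `IsGaloisDescent.galFunctor`.

Identities between maps into `D(S ×_R S)` or `DV` are checked on generalised elements of the form
`t ≫ D.map a` with a fixed `t`, where they reduce to identities between maps `a` in `A`; by
`IsGaloisDescent.exists_lift` all the composable tuples that occur have this form.
-/

/-! ### Monadicity and the choice of a left adjoint -/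

namespace CategoryTheory

/-- Whether the comparison functor of a right adjoint is an equivalence does not depend on the
choice of its left adjoint. -/
theorem Monad.isEquivalence_comparison_of_adjunction {C : Type u₁} [Category.{v₁} C]
    {D : Type u₂} [Category.{v₂} D] {L L' : C ⥤ D} {R : D ⥤ C} (h : L ⊣ R) (h' : L' ⊣ R)
    [(Monad.comparison h).IsEquivalence] : (Monad.comparison h').IsEquivalence := by
  let u : L ≅ L' := Adjunction.leftAdjointUniq h h'
  have hu (X : D) : u.hom.app (R.obj X) ≫ h'.counit.app X = h.counit.app X :=
    Adjunction.leftAdjointUniq_hom_app_counit h h' X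
  have hu' (X : D) : u.inv.app (R.obj X) ≫ h.counit.app X = h'.counit.app X :=
    Adjunction.leftAdjointUniq_hom_app_counit h' h X
  let i : h.toMonad ≅ h'.toMonad :=
    MonadIso.mk (Functor.isoWhiskerRight u R)
      (fun X => Adjunction.unit_leftAdjointUniq_hom_app h h' X)
      (fun X => by
        change R.map (h.counit.app (L.obj X)) ≫ R.map (u.hom.app X) =
          (R.map (L.map (R.map (u.hom.app X))) ≫ R.map (u.hom.app (R.obj (L'.obj X)))) ≫
            R.map (h'.counit.app (L'.obj X))
        simp only [← R.map_comp, Category.assoc, hu]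
        exact congr_arg R.map (h.counit_naturality (u.hom.app X)).symm)
  let j : Monad.comparison h ⋙ (Monad.algebraEquivOfIsoMonads i).functor ≅ Monad.comparison h' :=
    NatIso.ofComponents (fun X => Monad.Algebra.isoMk (Iso.refl (R.obj X)) (by
      change R.map (L'.map (𝟙 (R.obj X))) ≫ R.map (h'.counit.app X) =
        (R.map (u.inv.app (R.obj X)) ≫ R.map (h.counit.app X)) ≫ 𝟙 (R.obj X)
      rw [← R.map_comp (u.inv.app _), hu', L'.map_id, R.map_id]
      exact (Category.id_comp _).trans (Category.comp_id _).symm))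
      (fun {X Y} f => by
        ext
        change R.map f ≫ 𝟙 (R.obj Y) = 𝟙 (R.obj X) ≫ R.map f
        rw [Category.comp_id, Category.id_comp])
  exact Functor.isEquivalence_of_iso j

end CategoryTheory

noncomputable section

namespace CategoricalGalois

/-! ### Trivial objects over `S` -/

variable {A : Type u₁} [Category.{v₁} A] [HasPullbacks A] {P : Type u₂} [Category.{v₂} P]
  {D : A ⥤ P} {C : P ⥤ A} (adj : D ⊣ C)

/-- The objects of `A/S` at which the unit of the sliced adjunction is an isomorphism. When the
counit is an isomorphism they form the reflective subcategory of `A/S` equivalent to `P/DS`. -/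
def IsTrivial (S : A) : ObjectProperty (Over S) :=
  fun V => IsIso ((slicedAdj adj S).unit.app V)

variable {adj} {S : A}

theorem IsTrivial.of_iso {V W : Over S} (e : V ≅ W) (hV : IsTrivial adj S V) :
    IsTrivial adj S W :=
  (NatTrans.isIso_app_iff_of_iso (slicedAdj adj S).unit e).1 hV

/-- `D` is injective on morphisms over `S` into a trivial object. -/
theorem IsTrivial.map_injective {W Z : Over S} (hW : IsTrivial adj S W) {m n : Z ⟶ W}
    (h : D.map m.left = D.map n.left) : m = n := by
  have : IsIso ((slicedAdj adj S).unit.app W) := hW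
  have h' : (Over.post D).map m = (Over.post D).map n := Over.OverMorphism.ext h
  have hm := (slicedAdj adj S).unit_naturality m
  rw [h', (slicedAdj adj S).unit_naturality n] at hm
  exact ((cancel_mono ((slicedAdj adj S).unit.app W)).1 hm).symm

/-- `D` is surjective on morphisms over `S` into a trivial object. -/
theorem IsTrivial.exists_map_eq {W Z : Over S} (hW : IsTrivial adj S W)
    (f : D.obj Z.left ⟶ D.obj W.left) (hf : f ≫ D.map W.hom = D.map Z.hom) :
    ∃ m : Z ⟶ W, D.map m.left = f := by
  have : IsIso ((slicedAdj adj S).unit.app W) := hW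
  let f' : (Over.post D).obj Z ⟶ (Over.post D).obj W := Over.homMk f hf
  let m : Z ⟶ W :=
    (slicedAdj adj S).homEquiv _ _ f' ≫ inv ((slicedAdj adj S).unit.app W)
  have hm : (Over.post D).map m = f' := by
    apply ((slicedAdj adj S).homEquiv _ _).injective
    refine ((slicedAdj adj S).homEquiv_unit _ _ _).trans
      (((slicedAdj adj S).unit_naturality m).trans ?_)
    exact (Category.assoc _ _ _).trans
      ((congr_arg (_ ≫ ·) (IsIso.inv_hom_id _)).trans (Category.comp_id _))
  exact ⟨m, congr_arg CommaMorphism.left hm⟩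

/-- By the triangle identity, the unit at `C_S X` is inverse to the image of the counit at `X`. -/
theorem isTrivial_slicedRight [IsIso (slicedAdj adj S).counit] (X : Over (D.obj S)) :
    IsTrivial adj S ((slicedRight adj S).obj X) := by
  have h := (slicedAdj adj S).right_triangle_components X
  have : IsIso ((slicedAdj adj S).unit.app ((slicedRight adj S).obj X) ≫
      (slicedRight adj S).map ((slicedAdj adj S).counit.app X)) := by
    rw [h]; exact IsIso.id _
  exact IsIso.of_isIso_comp_right _ ((slicedRight adj S).map ((slicedAdj adj S).counit.app X))

/-- When the counit of the sliced adjunction is an isomorphism, every object over `DS` is, up to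
isomorphism, the image under `D` of a trivial object over `S`. -/
theorem exists_isTrivial_iso [IsIso (slicedAdj adj S).counit] {X : P} (φ : X ⟶ D.obj S) :
    ∃ (Z : Over S) (e : D.obj Z.left ≅ X), IsTrivial adj S Z ∧ e.hom ≫ φ = D.map Z.hom :=
  ⟨(slicedRight adj S).obj (Over.mk φ),
    (Over.forget _).mapIso (asIso ((slicedAdj adj S).counit.app (Over.mk φ))),
    isTrivial_slicedRight _, Over.w ((slicedAdj adj S).counit.app (Over.mk φ))⟩

theorem isTrivial_id [IsIso (slicedAdj adj S).counit] : IsTrivial adj S (Over.mk (𝟙 S)) := by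
  obtain ⟨Z, e, hZ, he⟩ := exists_isTrivial_iso (adj := adj) (𝟙 (D.obj S))
  rw [Category.comp_id] at he
  obtain ⟨m, hm⟩ := hZ.exists_map_eq (Z := Over.mk (𝟙 S)) e.inv (by simp [← he])
  refine hZ.of_iso (Over.isoMk ⟨Z.hom, m.left, ?_, ?_⟩ (by simp))
  · have : (Over.homMk Z.hom : Z ⟶ Over.mk (𝟙 S)) ≫ m = 𝟙 Z :=
      hZ.map_injective (by simp [hm, ← he])
    exact congr_arg CommaMorphism.left this
  · exact Over.w m

/-- When the sliced counit is invertible, `D` preserves binary products over `S` of trivial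
objects. -/
theorem isPullback_map_of_isTrivial [HasPullbacks P] [IsIso (slicedAdj adj S).counit]
    {U W : Over S} (hU : IsTrivial adj S U) (hW : IsTrivial adj S W) {Y : A} {p : Y ⟶ U.left}
    {q : Y ⟶ W.left} (h : IsPullback p q U.hom W.hom) :
    IsPullback (D.map p) (D.map q) (D.map U.hom) (D.map W.hom) := by
  -- The product of `DU` and `DW` over `DS` comes from a trivial object `Z`, which has the
  -- universal property of the product of `U` and `W` over `S`, so that `Y ≅ Z`.
  obtain ⟨Z, ε, hZ, hε⟩ := exists_isTrivial_iso (adj := adj)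
    (pullback.fst (D.map U.hom) (D.map W.hom) ≫ D.map U.hom)
  let Yo : Over S := Over.mk (p ≫ U.hom)
  let n : D.obj Y ⟶ pullback (D.map U.hom) (D.map W.hom) := pullback.lift (D.map p) (D.map q)
    (by rw [← D.map_comp, ← D.map_comp, h.w])
  have n_fst : n ≫ pullback.fst _ _ = D.map p := pullback.lift_fst _ _ _
  have n_snd : n ≫ pullback.snd _ _ = D.map q := pullback.lift_snd _ _ _
  obtain ⟨k, hk⟩ := hZ.exists_map_eq (Z := Yo) (n ≫ ε.inv)
    (by rw [← hε, Category.assoc, Iso.inv_hom_id_assoc, reassoc_of% n_fst, ← D.map_comp]; rfl)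
  obtain ⟨mU, hmU⟩ := hU.exists_map_eq (Z := Z) (ε.hom ≫ pullback.fst _ _)
    (by rw [Category.assoc, hε])
  obtain ⟨mW, hmW⟩ := hW.exists_map_eq (Z := Z) (ε.hom ≫ pullback.snd _ _)
    (by rw [Category.assoc, ← pullback.condition, hε])
  let m : Z.left ⟶ Y := h.lift mU.left mW.left (by rw [Over.w, Over.w])
  have m_fst : m ≫ p = mU.left := h.lift_fst _ _ _
  have m_snd : m ≫ q = mW.left := h.lift_snd _ _ _
  have hkm : k.left ≫ m = 𝟙 Y := by
    apply h.hom_ext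
    · have : k ≫ mU = (Over.homMk p : Yo ⟶ U) := hU.map_injective (by
        rw [Over.comp_left, D.map_comp, hk, hmU, Category.assoc, ε.inv_hom_id_assoc, n_fst]; rfl)
      rw [Category.assoc, m_fst]
      exact (congr_arg CommaMorphism.left this).trans (Category.id_comp p).symm
    · have : k ≫ mW = (Over.homMk q h.w.symm : Yo ⟶ W) := hW.map_injective (by
        rw [Over.comp_left, D.map_comp, hk, hmW, Category.assoc, ε.inv_hom_id_assoc, n_snd]; rfl)
      rw [Category.assoc, m_snd]
      exact (congr_arg CommaMorphism.left this).trans (Category.id_comp q).symm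
  have hmn : D.map m ≫ n = ε.hom := by
    apply pullback.hom_ext
    · rw [Category.assoc, n_fst, ← D.map_comp, m_fst, hmU]
    · rw [Category.assoc, n_snd, ← D.map_comp, m_snd, hmW]
  let i : D.obj Y ≅ pullback (D.map U.hom) (D.map W.hom) :=
    ⟨n, ε.inv ≫ D.map m, by rw [← Category.assoc, ← hk, ← D.map_comp]; exact
      (congr_arg D.map hkm).trans (D.map_id Y), by rw [Category.assoc, hmn, ε.inv_hom_id]⟩
  exact IsPullback.of_iso_pullback ⟨by rw [← D.map_comp, ← D.map_comp, h.w]⟩ i n_fst n_snd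

/-! ### Descent data along `σ` and split objects -/

variable {R V : A} {σ : S ⟶ R} {v : V ⟶ S}

attribute [local simp] pullback.lift_fst pullback.lift_snd pullback.lift_fst_assoc
  pullback.lift_snd_assoc

/-- A descent datum along `σ` on `v : V ⟶ S`: a map `V ×_R S ⟶ V`, written `(x, s) ↦ h (x, s)`,
such that `h (x, s)` lies over `s`, `h (x, v x) = x` and `h (h (x, s), s') = h (x, s')`. -/
structure IsDescentDatum (σ : S ⟶ R) (v : V ⟶ S) (h : pullback (v ≫ σ) σ ⟶ V) : Prop where
  comp_hom : h ≫ v = pullback.snd (v ≫ σ) σ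
  unit : pullback.lift (𝟙 V) v (Category.id_comp _) ≫ h = 𝟙 V
  assoc : pullback.lift (pullback.fst (pullback.snd (v ≫ σ) σ ≫ σ) σ ≫ pullback.fst (v ≫ σ) σ)
      (pullback.snd (pullback.snd (v ≫ σ) σ ≫ σ) σ)
      (by rw [Category.assoc, pullback.condition, pullback.condition]) ≫ h =
    pullback.lift (pullback.fst (pullback.snd (v ≫ σ) σ ≫ σ) σ ≫ h)
      (pullback.snd (pullback.snd (v ≫ σ) σ ≫ σ) σ)
      (by rw [Category.assoc, reassoc_of% comp_hom, pullback.condition]) ≫ h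

/-- The monad `σ^* Σ_σ` on `A/S`. -/
abbrev descentMonad (σ : S ⟶ R) : Monad (Over S) :=
  (Over.mapPullbackAdj σ).toMonad

theorem descentMonad_unit_left (σ : S ⟶ R) (V : Over S) :
    ((descentMonad σ).η.app V).left =
      (pullback.lift (𝟙 V.left) V.hom (Category.id_comp _) :
        V.left ⟶ pullback (V.hom ≫ σ) σ) :=
  congr_arg CommaMorphism.left (Over.mapPullbackAdj_unit_app σ V)

theorem descentMonad_mul_left (σ : S ⟶ R) (V : Over S) :
    ((descentMonad σ).μ.app V).left =
      (pullback.lift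
        (pullback.fst (pullback.snd (V.hom ≫ σ) σ ≫ σ) σ ≫ pullback.fst (V.hom ≫ σ) σ)
        (pullback.snd (pullback.snd (V.hom ≫ σ) σ ≫ σ) σ)
        (by rw [Category.assoc, pullback.condition, pullback.condition]) :
        _ ⟶ pullback (V.hom ≫ σ) σ) := by
  have h := congr_arg CommaMorphism.left
    (Over.mapPullbackAdj_counit_app σ ((Over.map σ).obj V))
  apply pullback.hom_ext
  · refine (pullback.lift_fst _ _ _).trans (.trans ?_ (pullback.lift_fst _ _ _).symm)
    exact congr_arg (_ ≫ ·) h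
  · exact (pullback.lift_snd _ _ _).trans (pullback.lift_snd _ _ _).symm

/-- The structure map of an algebra of `σ^* Σ_σ`, on underlying objects of `A`. -/
abbrev algebraStr (B : (descentMonad σ).Algebra) : pullback (B.A.hom ≫ σ) σ ⟶ B.A.left :=
  B.a.left

theorem isDescentDatum_algebraStr (B : (descentMonad σ).Algebra) :
    IsDescentDatum σ B.A.hom (algebraStr B) where
  comp_hom := Over.w B.a
  unit := (congr_arg (· ≫ algebraStr B) (descentMonad_unit_left σ B.A).symm).trans
    (congr_arg CommaMorphism.left B.unit)
  assoc := (congr_arg (· ≫ algebraStr B) (descentMonad_mul_left σ B.A).symm).trans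
    (congr_arg CommaMorphism.left B.assoc)

/-- The algebra of `σ^* Σ_σ` defined by a descent datum. -/
def IsDescentDatum.algebra {h : pullback (v ≫ σ) σ ⟶ V} (hh : IsDescentDatum σ v h) :
    (descentMonad σ).Algebra where
  A := Over.mk v
  a := Over.homMk h hh.comp_hom
  unit := Over.OverMorphism.ext
    ((congr_arg (· ≫ h) (descentMonad_unit_left σ (Over.mk v))).trans hh.unit)
  assoc := Over.OverMorphism.ext
    ((congr_arg (· ≫ h) (descentMonad_mul_left σ (Over.mk v))).trans hh.assoc)

/-- The algebras of `σ^* Σ_σ` whose underlying object is trivial. -/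
abbrev TrivialAlgebra (adj : D ⊣ C) (σ : S ⟶ R) :=
  ((IsTrivial adj S).inverseImage (descentMonad σ).forget).FullSubcategory

/-- The comparison functor of `Σ_σ ⊣ σ^*`, restricted to split objects. -/
def splitComparison (adj : D ⊣ C) (σ : S ⟶ R) : Split adj σ ⥤ TrivialAlgebra adj σ :=
  ObjectProperty.lift _ ((IsSplit adj σ).ι ⋙ Monad.comparison (Over.mapPullbackAdj σ))
    fun X => X.property

theorem IsGaloisDescent.isEquivalence_splitComparison (hσ : IsGaloisDescent adj σ) :
    (splitComparison adj σ).IsEquivalence := by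
  obtain ⟨h⟩ := hσ.monadic
  have := h.eqv
  have := Monad.isEquivalence_comparison_of_adjunction h.adj (Over.mapPullbackAdj σ)
  have : ((IsSplit adj σ).ι ⋙ Monad.comparison (Over.mapPullbackAdj σ)).Faithful :=
    Functor.Faithful.comp _ _
  have : ((IsSplit adj σ).ι ⋙ Monad.comparison (Over.mapPullbackAdj σ)).Full :=
    Functor.Full.comp _ _
  have : (splitComparison adj σ).Faithful :=
    Functor.Faithful.of_comp_iso (ObjectProperty.liftCompιIso _ _ _)
  have : (splitComparison adj σ).Full :=
    Functor.Full.of_comp_faithful_iso (ObjectProperty.liftCompιIso _ _ _)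
  have : (splitComparison adj σ).EssSurj := ⟨fun B => by
    let K := Monad.comparison (Over.mapPullbackAdj σ)
    let i : K.obj (K.objPreimage B.obj) ≅ B.obj := K.objObjPreimageIso B.obj
    exact ⟨⟨K.objPreimage B.obj,
      IsTrivial.of_iso ((descentMonad σ).forget.mapIso i).symm B.property⟩,
      ⟨ObjectProperty.isoMk _ i⟩⟩⟩
  exact { }

/-! ### The Galois groupoid -/

/-- For `v : V ⟶ S`, the map `V ×_R S ⟶ S ×_R S` given by `(x, s) ↦ (v x, s)`. -/
abbrev toKernelPair (σ : S ⟶ R) (v : V ⟶ S) : pullback (v ≫ σ) σ ⟶ pullback σ σ :=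
  pullback.lift (pullback.fst _ _ ≫ v) (pullback.snd _ _)
    (by rw [Category.assoc, pullback.condition])

theorem isPullback_toKernelPair (σ : S ⟶ R) (v : V ⟶ S) :
    IsPullback (toKernelPair σ v) (pullback.fst (v ≫ σ) σ) (pullback.fst σ σ) v := by
  refine IsPullback.of_right ?_ (pullback.lift_fst _ _ _) (IsPullback.of_hasPullback σ σ).flip
  rw [pullback.lift_snd]
  exact (IsPullback.of_hasPullback (v ≫ σ) σ).flip

/-- The monad `σ^* Σ_σ` preserves trivial objects. -/
theorem IsGaloisDescent.isTrivial_pullback (hσ : IsGaloisDescent adj σ)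
    (hV : IsTrivial adj S (Over.mk v)) : IsTrivial adj S (Over.mk (pullback.snd (v ≫ σ) σ)) := by
  have : IsIso ((slicedAdj adj S).unit.app (Over.mk v)) := hV
  exact IsTrivial.of_iso ((Over.map σ ⋙ Over.pullback σ).mapIso
    (asIso ((slicedAdj adj S).unit.app (Over.mk v)))).symm
    (hσ.isIso_unit ((Over.post D).obj (Over.mk v)))

/-- The second projection of the kernel pair is `σ^* Σ_σ` applied to the identity of `S`. -/
theorem IsGaloisDescent.isTrivial_snd (hσ : IsGaloisDescent adj σ) :
    IsTrivial adj S (Over.mk (pullback.snd σ σ)) := by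
  have := hσ.isIso_counit
  refine (hσ.isTrivial_pullback isTrivial_id).of_iso
    (Over.isoMk (pullback.congrHom (Category.id_comp σ) rfl) (by simp))

theorem IsGaloisDescent.isTrivial_fst (hσ : IsGaloisDescent adj σ) :
    IsTrivial adj S (Over.mk (pullback.fst σ σ)) :=
  hσ.isTrivial_snd.of_iso (Over.isoMk (pullbackSymmetry σ σ) (by simp))

variable [HasPullbacks P]

theorem IsGaloisDescent.isPullback_map (hσ : IsGaloisDescent adj σ)
    (hV : IsTrivial adj S (Over.mk v)) :
    IsPullback (D.map (toKernelPair σ v)) (D.map (pullback.fst (v ≫ σ) σ))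
      (D.map (pullback.fst σ σ)) (D.map v) :=
  have := hσ.isIso_counit
  isPullback_map_of_isTrivial hσ.isTrivial_fst hV (isPullback_toKernelPair σ v)

/-- For a trivial `V` over `S`, the object of pairs `(g, x)` formed by a morphism `g` of the Galois
groupoid and an element `x` of `DV` over its domain is `D(V ×_R S)`. -/
def IsGaloisDescent.actionIso (hσ : IsGaloisDescent adj σ) (hV : IsTrivial adj S (Over.mk v)) :
    pullback (D.map (pullback.fst σ σ)) (D.map v) ≅ D.obj (pullback (v ≫ σ) σ) :=
  (hσ.isPullback_map hV).isoPullback.symm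

theorem IsGaloisDescent.actionIso_inv (hσ : IsGaloisDescent adj σ)
    (hV : IsTrivial adj S (Over.mk v)) :
    (hσ.actionIso hV).inv = pullback.lift (D.map (toKernelPair σ v)) (D.map (pullback.fst _ _))
      (hσ.isPullback_map hV).w := by
  apply pullback.hom_ext <;> simp [actionIso]

/-- The isomorphism `actionIso` computed at a generalised element of the form `(t ≫ D a, t ≫ D y)`. -/
theorem IsGaloisDescent.lift_actionIso_hom (hσ : IsGaloisDescent adj σ)
    (hV : IsTrivial adj S (Over.mk v)) {T : P} {Z : A} (t : T ⟶ D.obj Z) (a : Z ⟶ pullback σ σ)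
    (y : Z ⟶ V) (w : a ≫ pullback.fst σ σ = y ≫ v) {f : T ⟶ D.obj (pullback σ σ)}
    {x : T ⟶ D.obj V} (hf : f = t ≫ D.map a) (hx : x = t ≫ D.map y)
    (hfx : f ≫ D.map (pullback.fst σ σ) = x ≫ D.map v) :
    pullback.lift f x hfx ≫ (hσ.actionIso hV).hom =
      t ≫ D.map (pullback.lift y (a ≫ pullback.snd σ σ)
        (by rw [← reassoc_of% w, Category.assoc, pullback.condition])) := by
  rw [← Iso.eq_comp_inv, actionIso_inv]
  subst hf hx
  apply pullback.hom_ext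
  · simp only [pullback.lift_fst, Category.assoc, ← D.map_comp]
    congr 2
    apply pullback.hom_ext <;> simp [w]
  · simp only [pullback.lift_snd, Category.assoc, ← D.map_comp, pullback.lift_fst]

/-- A compatible pair of generalised elements of `DV` and of `D(S ×_R S)` is a generalised element
of `D(V ×_R S)`. -/
theorem IsGaloisDescent.exists_lift (hσ : IsGaloisDescent adj σ)
    (hV : IsTrivial adj S (Over.mk v)) {T : P} (x : T ⟶ D.obj V) (g : T ⟶ D.obj (pullback σ σ))
    (h : g ≫ D.map (pullback.fst σ σ) = x ≫ D.map v) :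
    ∃ t : T ⟶ D.obj (pullback (v ≫ σ) σ), x = t ≫ D.map (pullback.fst _ _) ∧
      g = t ≫ D.map (toKernelPair σ v) :=
  ⟨(hσ.isPullback_map hV).lift g x h, ((hσ.isPullback_map hV).lift_snd _ _ _).symm,
    ((hσ.isPullback_map hV).lift_fst _ _ _).symm⟩

/-- Composition in the Galois groupoid, `(s₀, s₁), (s₁, s₂) ↦ (s₀, s₂)`. -/
def IsGaloisDescent.galComp (hσ : IsGaloisDescent adj σ) :
    pullback (D.map (pullback.snd σ σ)) (D.map (pullback.fst σ σ)) ⟶ D.obj (pullback σ σ) :=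
  (pullbackSymmetry _ _).hom ≫ (hσ.actionIso hσ.isTrivial_snd).hom ≫
    D.map (pullback.lift (pullback.fst (pullback.snd σ σ ≫ σ) σ ≫ pullback.fst σ σ)
      (pullback.snd (pullback.snd σ σ ≫ σ) σ)
      (by rw [Category.assoc, pullback.condition, pullback.condition]))

/-- Composition in the Galois groupoid computed at a composable pair `(t ≫ D a, t ≫ D b)`. -/
theorem IsGaloisDescent.lift_galComp (hσ : IsGaloisDescent adj σ) {T : P} {Z : A}
    (t : T ⟶ D.obj Z) (a b : Z ⟶ pullback σ σ) (w : a ≫ pullback.snd σ σ = b ≫ pullback.fst σ σ)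
    {f g : T ⟶ D.obj (pullback σ σ)} (hf : f = t ≫ D.map a) (hg : g = t ≫ D.map b)
    (hfg : f ≫ D.map (pullback.snd σ σ) = g ≫ D.map (pullback.fst σ σ)) :
    pullback.lift f g hfg ≫ hσ.galComp =
      t ≫ D.map (pullback.lift (a ≫ pullback.fst σ σ) (b ≫ pullback.snd σ σ)
        (by rw [Category.assoc, pullback.condition, reassoc_of% w, pullback.condition,
          Category.assoc])) := by
  have h : pullback.lift f g hfg ≫ (pullbackSymmetry _ _).hom = pullback.lift g f hfg.symm := by
    apply pullback.hom_ext <;> simp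
  rw [galComp, reassoc_of% h, reassoc_of% (hσ.lift_actionIso_hom hσ.isTrivial_snd t b a w.symm hg hf
    hfg.symm), ← D.map_comp]
  congr 2
  apply pullback.hom_ext <;> simp

/-- Associativity at a composable triple `(t ≫ D a, t ≫ D b, t ≫ D c)`: both sides come from
the pair formed by the first component of `a` and the second component of `c`. -/
theorem IsGaloisDescent.galComp_assoc (hσ : IsGaloisDescent adj σ) {T : P} {Z : A}
    (t : T ⟶ D.obj Z) (a b c : Z ⟶ pullback σ σ)
    (hab : a ≫ pullback.snd σ σ = b ≫ pullback.fst σ σ)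
    (hbc : b ≫ pullback.snd σ σ = c ≫ pullback.fst σ σ)
    {f g h : T ⟶ D.obj (pullback σ σ)} (hf : f = t ≫ D.map a) (hg : g = t ≫ D.map b)
    (hh : h = t ≫ D.map c)
    (hfg : f ≫ D.map (pullback.snd σ σ) = g ≫ D.map (pullback.fst σ σ))
    (hgh : g ≫ D.map (pullback.snd σ σ) = h ≫ D.map (pullback.fst σ σ))
    (w₁ : (pullback.lift f g hfg ≫ hσ.galComp) ≫ D.map (pullback.snd σ σ) =
      h ≫ D.map (pullback.fst σ σ))
    (w₂ : f ≫ D.map (pullback.snd σ σ) =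
      (pullback.lift g h hgh ≫ hσ.galComp) ≫ D.map (pullback.fst σ σ)) :
    pullback.lift (pullback.lift f g hfg ≫ hσ.galComp) h w₁ ≫ hσ.galComp =
      pullback.lift f (pullback.lift g h hgh ≫ hσ.galComp) w₂ ≫ hσ.galComp := by
  rw [hσ.lift_galComp t _ c (by simp [hbc]) (hσ.lift_galComp t a b hab hf hg hfg) hh w₁,
    hσ.lift_galComp t a _ (by simp [hab]) hf (hσ.lift_galComp t b c hbc hg hh hgh) w₂]
  congr 2
  apply pullback.hom_ext <;> simp

/-- The Galois groupoid of `σ`: the image under `D` of the kernel pair of `σ`, seen as a groupoid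
with object of objects `S` and with exactly one morphism from `s₀` to `s₁` when `σ s₀ = σ s₁`. -/
def IsGaloisDescent.gal (hσ : IsGaloisDescent adj σ) : InternalGroupoid P where
  obj := D.obj S
  mor := D.obj (pullback σ σ)
  dom := D.map (pullback.fst σ σ)
  cod := D.map (pullback.snd σ σ)
  ident := D.map (pullback.lift (𝟙 S) (𝟙 S))
  comp := hσ.galComp
  inv := D.map (pullback.lift (pullback.snd σ σ) (pullback.fst σ σ) pullback.condition.symm)
  ident_dom := by rw [← D.map_comp, pullback.lift_fst, D.map_id]
  ident_cod := by rw [← D.map_comp, pullback.lift_snd, D.map_id]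
  comp_dom := by
    obtain ⟨t, hg, hf⟩ := hσ.exists_lift hσ.isTrivial_snd
      (pullback.fst (D.map (pullback.snd σ σ)) (D.map (pullback.fst σ σ))) (pullback.snd _ _)
      pullback.condition.symm
    have h := hσ.lift_galComp t _ _ (by simp) hg hf pullback.condition
    rw [pullback.lift_fst_snd, Category.id_comp] at h
    rw [h, hg, Category.assoc t, Category.assoc t, ← D.map_comp, ← D.map_comp, pullback.lift_fst]
  comp_cod := by
    obtain ⟨t, hg, hf⟩ := hσ.exists_lift hσ.isTrivial_snd
      (pullback.fst (D.map (pullback.snd σ σ)) (D.map (pullback.fst σ σ))) (pullback.snd _ _)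
      pullback.condition.symm
    have h := hσ.lift_galComp t _ _ (by simp) hg hf pullback.condition
    rw [pullback.lift_fst_snd, Category.id_comp] at h
    rw [h, hf, Category.assoc t, Category.assoc t, ← D.map_comp, ← D.map_comp, pullback.lift_snd]
  ident_comp := by
    refine (hσ.lift_galComp (𝟙 _) (pullback.fst σ σ ≫ pullback.lift (𝟙 S) (𝟙 S)) (𝟙 _) (by simp)
      (by simp) (by simp) _).trans ?_
    rw [Category.id_comp, ← D.map_id]
    congr 1
    apply pullback.hom_ext <;> simp
  comp_ident := by
    refine (hσ.lift_galComp (𝟙 _) (𝟙 _) (pullback.snd σ σ ≫ pullback.lift (𝟙 S) (𝟙 S)) (by simp)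
      (by simp) (by simp) _).trans ?_
    rw [Category.id_comp, ← D.map_id]
    congr 1
    apply pullback.hom_ext <;> simp
  assoc := by
    intro T f g h hfg hgh
    -- The triple comes from a single map `t'` into `D(S ×_R S ×_R S ×_R S)`.
    obtain ⟨t, ht₁, ht₂⟩ := hσ.exists_lift hσ.isTrivial_snd f g hfg.symm
    obtain ⟨t', ht, ht₃⟩ := hσ.exists_lift (hσ.isTrivial_pullback hσ.isTrivial_snd) t h
      (by rw [← hgh, ht₂, Category.assoc, ← D.map_comp, pullback.lift_snd])
    rw [ht, Category.assoc, ← D.map_comp] at ht₁ ht₂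
    exact hσ.galComp_assoc t' _ _ _ (by simp) (by simp) ht₁ ht₂ ht₃ hfg hgh _ _
  inv_dom := by rw [← D.map_comp, pullback.lift_fst]
  inv_cod := by rw [← D.map_comp, pullback.lift_snd]
  comp_inv := by
    refine (hσ.lift_galComp (𝟙 _) (𝟙 _) (pullback.lift (pullback.snd σ σ) (pullback.fst σ σ)
      pullback.condition.symm) (by simp) (by simp) (by simp) _).trans ?_
    rw [Category.id_comp, ← D.map_comp]
    congr 1
    apply pullback.hom_ext <;> simp
  inv_comp := by
    refine (hσ.lift_galComp (𝟙 _) (pullback.lift (pullback.snd σ σ) (pullback.fst σ σ)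
      pullback.condition.symm) (𝟙 _) (by simp) (by simp) (by simp) _).trans ?_
    rw [Category.id_comp, ← D.map_comp]
    congr 1
    apply pullback.hom_ext <;> simp

/-! ### Descent data as actions of the Galois groupoid -/

/-- The map `(g, x) ↦ h (x, cod g)` from the pairs of a morphism `g` of the Galois groupoid and an
element `x` of `DV` over its domain, for `h : V ×_R S ⟶ V`. -/
def IsGaloisDescent.galAct (hσ : IsGaloisDescent adj σ) (hV : IsTrivial adj S (Over.mk v))
    (h : pullback (v ≫ σ) σ ⟶ V) :
    pullback (D.map (pullback.fst σ σ)) (D.map v) ⟶ D.obj V :=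
  (hσ.actionIso hV).hom ≫ D.map h

/-- The action computed at a generalised element of the form `(t ≫ D a, t ≫ D y)`. -/
theorem IsGaloisDescent.lift_galAct (hσ : IsGaloisDescent adj σ)
    (hV : IsTrivial adj S (Over.mk v)) (h : pullback (v ≫ σ) σ ⟶ V) {T : P} {Z : A}
    (t : T ⟶ D.obj Z) (a : Z ⟶ pullback σ σ) (y : Z ⟶ V) (w : a ≫ pullback.fst σ σ = y ≫ v)
    {f : T ⟶ D.obj (pullback σ σ)} {x : T ⟶ D.obj V} (hf : f = t ≫ D.map a)
    (hx : x = t ≫ D.map y) (hfx : f ≫ D.map (pullback.fst σ σ) = x ≫ D.map v) :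
    pullback.lift f x hfx ≫ hσ.galAct hV h =
      t ≫ D.map (pullback.lift y (a ≫ pullback.snd σ σ)
        (by rw [← reassoc_of% w, Category.assoc, pullback.condition]) ≫ h) := by
  rw [galAct, reassoc_of% (hσ.lift_actionIso_hom hV t a y w hf hx hfx), D.map_comp]

theorem IsGaloisDescent.galAct_anchor (hσ : IsGaloisDescent adj σ)
    (hV : IsTrivial adj S (Over.mk v)) {h : pullback (v ≫ σ) σ ⟶ V} (hh : IsDescentDatum σ v h) :
    hσ.galAct hV h ≫ D.map v =
      pullback.fst (D.map (pullback.fst σ σ)) (D.map v) ≫ D.map (pullback.snd σ σ) := by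
  rw [galAct, Category.assoc, ← D.map_comp, hh.comp_hom, ← Iso.eq_inv_comp, actionIso_inv,
    pullback.lift_fst_assoc, ← D.map_comp, pullback.lift_snd]

theorem IsGaloisDescent.ident_galAct (hσ : IsGaloisDescent adj σ)
    (hV : IsTrivial adj S (Over.mk v)) {h : pullback (v ≫ σ) σ ⟶ V} (hh : IsDescentDatum σ v h)
    (w : (D.map v ≫ D.map (pullback.lift (𝟙 S) (𝟙 S))) ≫ D.map (pullback.fst σ σ) =
      𝟙 (D.obj V) ≫ D.map v) :
    pullback.lift (D.map v ≫ D.map (pullback.lift (𝟙 S) (𝟙 S))) (𝟙 (D.obj V)) w ≫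
      hσ.galAct hV h = 𝟙 (D.obj V) := by
  rw [hσ.lift_galAct hV h (𝟙 _) (v ≫ pullback.lift (𝟙 S) (𝟙 S)) (𝟙 V) (by simp) (by simp)
    (by simp) w, Category.id_comp, ← D.map_id]
  congr 1
  refine .trans ?_ hh.unit
  congr 1
  apply pullback.hom_ext <;> simp

theorem IsGaloisDescent.comp_galAct (hσ : IsGaloisDescent adj σ)
    (hV : IsTrivial adj S (Over.mk v)) {h : pullback (v ≫ σ) σ ⟶ V} (hh : IsDescentDatum σ v h)
    {T : P} (f g : T ⟶ D.obj (pullback σ σ)) (x : T ⟶ D.obj V)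
    (hfg : f ≫ D.map (pullback.snd σ σ) = g ≫ D.map (pullback.fst σ σ))
    (hfx : f ≫ D.map (pullback.fst σ σ) = x ≫ D.map v)
    (w₁ : (pullback.lift f g hfg ≫ hσ.galComp) ≫ D.map (pullback.fst σ σ) = x ≫ D.map v)
    (w₂ : g ≫ D.map (pullback.fst σ σ) = (pullback.lift f x hfx ≫ hσ.galAct hV h) ≫ D.map v) :
    pullback.lift (pullback.lift f g hfg ≫ hσ.galComp) x w₁ ≫ hσ.galAct hV h =
      pullback.lift g (pullback.lift f x hfx ≫ hσ.galAct hV h) w₂ ≫ hσ.galAct hV h := by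
  -- `x`, `f` and `g` are all images of maps in `A` along a single `t' : T ⟶ D(V ×_R S ×_R S)`.
  obtain ⟨t, hx, hf⟩ := hσ.exists_lift hV x f hfx
  obtain ⟨t', ht, hg⟩ := hσ.exists_lift (hσ.isTrivial_pullback hV) t g
    (by rw [← hfg, hf, Category.assoc, ← D.map_comp, pullback.lift_snd])
  rw [ht, Category.assoc, ← D.map_comp] at hx hf
  have e := hσ.lift_galComp t' _ _ (by simp) hf hg hfg
  have e' := hσ.lift_galAct hV h t' _ _ (by simp) hf hx hfx
  rw [hσ.lift_galAct hV h t' _ _ (by simp) e hx w₁,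
    hσ.lift_galAct hV h t' _ _ (by simp [hh.comp_hom]) hg e' w₂]
  congr 2
  refine .trans ?_ (hh.assoc.trans ?_)
  · congr 1
    apply pullback.hom_ext <;> simp
  · congr 1
    apply pullback.hom_ext
    · simp only [pullback.lift_fst]
      congr 1
      apply pullback.hom_ext <;> simp
    · simp

/-- The `Gal[σ]`-object `DV` defined by a descent datum on a trivial `V`. -/
def IsGaloisDescent.galObject (hσ : IsGaloisDescent adj σ) (B : (descentMonad σ).Algebra)
    (hB : IsTrivial adj S B.A) : hσ.gal.GObject where
  carrier := D.obj B.A.left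
  anchor := D.map B.A.hom
  act := hσ.galAct hB (algebraStr B)
  act_anchor := hσ.galAct_anchor hB (isDescentDatum_algebraStr B)
  ident_act := hσ.ident_galAct hB (isDescentDatum_algebraStr B) _
  comp_act f g x hfg hfx :=
    hσ.comp_galAct hB (isDescentDatum_algebraStr B) f g x hfg hfx _ _

/-- A map over `S` between trivial objects is compatible with descent data if and only if its image
under `D` is equivariant. -/
theorem IsGaloisDescent.galAct_map_iff (hσ : IsGaloisDescent adj σ)
    (hV : IsTrivial adj S (Over.mk v)) {h : pullback (v ≫ σ) σ ⟶ V} (hh : IsDescentDatum σ v h)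
    {W : A} {w : W ⟶ S} (hW : IsTrivial adj S (Over.mk w)) {k : pullback (w ≫ σ) σ ⟶ W}
    (hk : IsDescentDatum σ w k) (f : V ⟶ W) (hf : f ≫ w = v)
    (hDf : pullback.fst (D.map (pullback.fst σ σ)) (D.map v) ≫ D.map (pullback.fst σ σ) =
      (pullback.snd (D.map (pullback.fst σ σ)) (D.map v) ≫ D.map f) ≫ D.map w) :
    hσ.galAct hV h ≫ D.map f = pullback.lift (pullback.fst _ _) (pullback.snd _ _ ≫ D.map f) hDf ≫
        hσ.galAct hW k ↔
      h ≫ f = pullback.lift (pullback.fst (v ≫ σ) σ ≫ f) (pullback.snd (v ≫ σ) σ)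
        (by rw [Category.assoc, reassoc_of% hf, pullback.condition]) ≫ k := by
  have e₁ : pullback.fst (D.map (pullback.fst σ σ)) (D.map v) =
      (hσ.actionIso hV).hom ≫ D.map (toKernelPair σ v) := by
    rw [← Iso.inv_comp_eq, actionIso_inv, pullback.lift_fst]
  have e₂ : pullback.snd (D.map (pullback.fst σ σ)) (D.map v) ≫ D.map f =
      (hσ.actionIso hV).hom ≫ D.map (pullback.fst (v ≫ σ) σ ≫ f) := by
    rw [← Iso.inv_comp_eq, actionIso_inv, pullback.lift_snd_assoc, D.map_comp]
  rw [hσ.lift_galAct hW k (hσ.actionIso hV).hom _ _ (by simp [hf]) e₁ e₂ hDf, galAct,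
    Category.assoc, ← D.map_comp, cancel_epi]
  have e : pullback.lift (f := w ≫ σ) (g := σ) (pullback.fst (v ≫ σ) σ ≫ f)
      (toKernelPair σ v ≫ pullback.snd σ σ) (by simp [reassoc_of% hf, pullback.condition]) =
      pullback.lift (f := w ≫ σ) (pullback.fst (v ≫ σ) σ ≫ f) (pullback.snd (v ≫ σ) σ)
        (by rw [Category.assoc, reassoc_of% hf, pullback.condition]) := by
    apply pullback.hom_ext <;> simp
  rw [e]
  refine ⟨fun H => ?_, fun H => congr_arg D.map H⟩
  have := hW.map_injective
    (m := (Over.homMk (h ≫ f) (by simp [hf, hh.comp_hom]) :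
      Over.mk (pullback.snd (v ≫ σ) σ) ⟶ Over.mk w))
    (n := Over.homMk (pullback.lift (f := w ≫ σ) (pullback.fst (v ≫ σ) σ ≫ f)
      (pullback.snd (v ≫ σ) σ) (by rw [Category.assoc, reassoc_of% hf, pullback.condition]) ≫ k)
        (by simp [hk.comp_hom])) H
  exact congr_arg CommaMorphism.left this

/-- Every `Gal[σ]`-object comes from a descent datum on a trivial object. -/
theorem IsGaloisDescent.exists_descentDatum (hσ : IsGaloisDescent adj σ) {X : P}
    (φ : X ⟶ D.obj S) (act : pullback (D.map (pullback.fst σ σ)) φ ⟶ X)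
    (act_anchor : act ≫ φ = pullback.fst _ _ ≫ D.map (pullback.snd σ σ))
    (ident_act : ∀ w, pullback.lift (φ ≫ D.map (pullback.lift (𝟙 S) (𝟙 S))) (𝟙 X) w ≫ act = 𝟙 X)
    (comp_act : ∀ {T : P} (f g : T ⟶ D.obj (pullback σ σ)) (x : T ⟶ X)
      (hfg : f ≫ D.map (pullback.snd σ σ) = g ≫ D.map (pullback.fst σ σ))
      (hfx : f ≫ D.map (pullback.fst σ σ) = x ≫ φ) (w₁) (w₂),
      pullback.lift (pullback.lift f g hfg ≫ hσ.galComp) x w₁ ≫ act =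
        pullback.lift g (pullback.lift f x hfx ≫ act) w₂ ≫ act) :
    ∃ (V : A) (v : V ⟶ S) (h : pullback (v ≫ σ) σ ⟶ V) (e : D.obj V ≅ X)
      (hV : IsTrivial adj S (Over.mk v)) (he : e.hom ≫ φ = D.map v), IsDescentDatum σ v h ∧
      hσ.galAct hV h ≫ e.hom = pullback.lift (pullback.fst _ _) (pullback.snd _ _ ≫ e.hom)
        (by rw [Category.assoc, he, pullback.condition]) ≫ act := by
  have := hσ.isIso_counit
  obtain ⟨Z, e, hZ, he⟩ := exists_isTrivial_iso (adj := adj) φ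
  obtain ⟨V, v, rfl⟩ : ∃ (V : A) (v : V ⟶ S), Z = Over.mk v := ⟨Z.left, Z.hom, rfl⟩
  change D.obj V ≅ X at e
  change e.hom ≫ φ = D.map v at he
  have hw {Y : A} {a : Y ⟶ pullback σ σ} {y : Y ⟶ V} (w : a ≫ pullback.fst σ σ = y ≫ v) :
      D.map a ≫ D.map (pullback.fst σ σ) = (D.map y ≫ e.hom) ≫ φ := by
    rw [Category.assoc, he, ← D.map_comp, ← D.map_comp, w]
  have hκ : toKernelPair σ v ≫ pullback.fst σ σ = pullback.fst (v ≫ σ) σ ≫ v :=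
    pullback.lift_fst _ _ _
  obtain ⟨m, hm⟩ := hZ.exists_map_eq (Z := Over.mk (pullback.snd (v ≫ σ) σ))
    (pullback.lift (D.map (toKernelPair σ v)) (D.map (pullback.fst (v ≫ σ) σ) ≫ e.hom) (hw hκ) ≫
      act ≫ e.inv) (by
        change _ ≫ D.map v = D.map (pullback.snd (v ≫ σ) σ)
        rw [← he, Category.assoc, Category.assoc, e.inv_hom_id_assoc, act_anchor,
          pullback.lift_fst_assoc, ← D.map_comp, pullback.lift_snd])
  let h : pullback (v ≫ σ) σ ⟶ V := m.left
  have h_hom : h ≫ v = pullback.snd (v ≫ σ) σ := Over.w m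
  have hh : D.map h ≫ e.hom = pullback.lift (D.map (toKernelPair σ v))
      (D.map (pullback.fst (v ≫ σ) σ) ≫ e.hom) (hw hκ) ≫ act := by
    rw [← Iso.eq_comp_inv, Category.assoc]
    exact hm
  -- `h` is computed on generalised elements by the action.
  have key {Y : A} (a : Y ⟶ pullback σ σ) (y : Y ⟶ V) (w : a ≫ pullback.fst σ σ = y ≫ v)
      (r : Y ⟶ pullback (v ≫ σ) σ) (hr : r ≫ pullback.fst _ _ = y)
      (hr' : r ≫ pullback.snd _ _ = a ≫ pullback.snd σ σ) :
      D.map (r ≫ h) ≫ e.hom = pullback.lift (D.map a) (D.map y ≫ e.hom) (hw w) ≫ act := by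
    rw [D.map_comp, Category.assoc, hh, ← Category.assoc]
    congr 1
    apply pullback.hom_ext
    · have : r ≫ toKernelPair σ v = a := by
        apply pullback.hom_ext
        · simp [reassoc_of% hr, w]
        · simp [hr']
      simp only [Category.assoc, pullback.lift_fst, ← D.map_comp, this]
    · simp only [Category.assoc, pullback.lift_snd, ← D.map_comp_assoc, hr]
  -- `h` is unique with this property, so its axioms may be checked after applying `D`.
  have inj {Y : A} {r s : Y ⟶ V} (hrs : r ≫ v = s ≫ v) (H : D.map r ≫ e.hom = D.map s ≫ e.hom) :
      r = s := by
    have := hZ.map_injective (m := (Over.homMk r hrs : Over.mk (s ≫ v) ⟶ Over.mk v))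
      (n := Over.homMk s) ((cancel_mono e.hom).1 H)
    exact congr_arg CommaMorphism.left this
  refine ⟨V, v, h, e, hZ, he, ⟨h_hom, ?_, ?_⟩, ?_⟩
  · apply inj (by rw [Category.assoc, h_hom, pullback.lift_snd, Category.id_comp])
    rw [key (v ≫ pullback.lift (𝟙 S) (𝟙 S)) (𝟙 V) (by simp) _ (by simp) (by simp)]
    simp only [D.map_id, Category.id_comp]
    refine .trans ?_ ((congr_arg (e.hom ≫ ·) (ident_act (by simp [← D.map_comp]))).trans
      (Category.comp_id _))
    rw [← Category.assoc e.hom]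
    congr 1
    apply pullback.hom_ext
    · simp [← he]
    · simp
  · apply inj (by simp [h_hom])
    -- On `V ×_R S ×_R S`, with elements `(x, s, s')`, these are `a = (v x, s)`, `b = (s, s')` and
    -- `y = x`.
    let a := pullback.fst (pullback.snd (v ≫ σ) σ ≫ σ) σ ≫ toKernelPair σ v
    let b := toKernelPair σ (pullback.snd (v ≫ σ) σ)
    let y := pullback.fst (pullback.snd (v ≫ σ) σ ≫ σ) σ ≫ pullback.fst (v ≫ σ) σ
    have hab : a ≫ pullback.snd σ σ = b ≫ pullback.fst σ σ := by simp [a, b]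
    have hay : a ≫ pullback.fst σ σ = y ≫ v := by simp [a, y]
    have hDab : D.map a ≫ D.map (pullback.snd σ σ) = D.map b ≫ D.map (pullback.fst σ σ) := by
      rw [← D.map_comp, ← D.map_comp, hab]
    have ha := key a y hay (pullback.fst _ _) rfl (by simp [a])
    have hc := hσ.lift_galComp (𝟙 _) a b hab (Category.id_comp _).symm (Category.id_comp _).symm
      hDab
    rw [Category.id_comp] at hc
    rw [key (pullback.lift (a ≫ pullback.fst σ σ) (b ≫ pullback.snd σ σ) (by
        rw [Category.assoc, pullback.condition, reassoc_of% hab, pullback.condition,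
          Category.assoc])) y (by rw [pullback.lift_fst, hay]) _ (by simp [y]) (by simp [b]),
      key b _ (by simp [b, h_hom]) _ (pullback.lift_fst _ _ _) (by simp [b])]
    refine .trans ?_ ((comp_act (D.map a) (D.map b) (D.map y ≫ e.hom) hDab (hw hay)
      (by rw [hc]; exact hw (by rw [pullback.lift_fst, hay]))
      (by rw [← ha]; exact hw (by simp [b, h_hom]))).trans ?_)
    · simp only [hc]
    · simp only [ha]
  · rw [galAct, Category.assoc, ← Iso.eq_inv_comp, hh, actionIso_inv, ← Category.assoc]
    congr 1
    apply pullback.hom_ext <;> simp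

/-! ### The equivalence with `Gal[σ]`-objects -/

/-- An equivariant map whose underlying map is invertible is an isomorphism of `G`-objects. -/
def InternalGroupoid.GObject.isoMk
    {G : InternalGroupoid P} {X Y : G.GObject} (e : X.carrier ≅ Y.carrier)
    (h : e.hom ≫ Y.anchor = X.anchor)
    (h' : X.act ≫ e.hom = pullback.lift (pullback.fst G.dom X.anchor)
      (pullback.snd G.dom X.anchor ≫ e.hom)
      (by rw [Category.assoc, h, pullback.condition]) ≫ Y.act) : X ≅ Y where
  hom := ⟨e.hom, h, h'⟩
  inv := ⟨e.inv, by rw [← h, e.inv_hom_id_assoc], by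
    rw [← cancel_mono e.hom, Category.assoc, Category.assoc, h', e.inv_hom_id, Category.comp_id,
      ← Category.assoc]
    refine (Category.id_comp _).symm.trans ?_
    congr 1
    apply pullback.hom_ext <;> simp⟩
  hom_inv_id := GObject.Hom.ext e.hom_inv_id
  inv_hom_id := GObject.Hom.ext e.inv_hom_id

/-- The functor sending an algebra on a trivial object `V` to `DV` with the induced action. -/
def IsGaloisDescent.galFunctor (hσ : IsGaloisDescent adj σ) :
    TrivialAlgebra adj σ ⥤ hσ.gal.GObject where
  obj B := hσ.galObject B.obj B.property
  map {B B'} f :=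
    { hom := D.map f.hom.f.left
      hom_anchor := (D.map_comp _ _).symm.trans (congr_arg D.map (Over.w f.hom.f))
      act_hom := (hσ.galAct_map_iff B.property (isDescentDatum_algebraStr B.obj) B'.property
        (isDescentDatum_algebraStr B'.obj) f.hom.f.left (Over.w f.hom.f) _).2
          (congr_arg CommaMorphism.left f.hom.h).symm }
  map_id _ := InternalGroupoid.GObject.Hom.ext (D.map_id _)
  map_comp _ _ := InternalGroupoid.GObject.Hom.ext (D.map_comp _ _)

instance (hσ : IsGaloisDescent adj σ) : hσ.galFunctor.Faithful where
  map_injective {B B'} f g H := by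
    apply ObjectProperty.hom_ext
    apply Monad.Algebra.Hom.ext
    exact IsTrivial.map_injective B'.property
      (congr_arg InternalGroupoid.GObject.Hom.hom H)

instance (hσ : IsGaloisDescent adj σ) : hσ.galFunctor.Full where
  map_surjective {B B'} k := by
    obtain ⟨m, hm⟩ := IsTrivial.exists_map_eq (Z := B.obj.A) B'.property k.hom k.hom_anchor
    have hk := k.act_hom
    simp only [← hm] at hk
    let f : B.obj ⟶ B'.obj :=
      { f := m
        h := Over.OverMorphism.ext ((hσ.galAct_map_iff B.property
          (isDescentDatum_algebraStr B.obj) B'.property (isDescentDatum_algebraStr B'.obj) m.left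
          (Over.w m) _).1 hk).symm }
    exact ⟨ObjectProperty.homMk f, InternalGroupoid.GObject.Hom.ext hm⟩

instance (hσ : IsGaloisDescent adj σ) : hσ.galFunctor.EssSurj where
  mem_essImage X := by
    obtain ⟨V, v, h, e, hV, he, hh, H⟩ := hσ.exists_descentDatum X.anchor X.act X.act_anchor
      (fun _ => X.ident_act) (fun f g x hfg hfx _ _ => X.comp_act f g x hfg hfx)
    exact ⟨⟨hh.algebra, hV⟩, ⟨InternalGroupoid.GObject.isoMk e he H⟩⟩

end CategoricalGalois

end

theorem mainTheorem1
    {A : Type u₁} [Category.{v₁} A] [HasPullbacks A]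
    {P : Type u₂} [Category.{v₂} P] [HasPullbacks P]
    {D : A ⥤ P} {C : P ⥤ A} (adj : D ⊣ C)
    {S R : A} (σ : S ⟶ R) (hσ : CategoricalGalois.IsGaloisDescent adj σ) :
    ∃ Gal : CategoricalGalois.InternalGroupoid P,
      Nonempty (CategoricalGalois.Split adj σ ≌ Gal.GObject) := by
  have := hσ.isEquivalence_splitComparison
  have : hσ.galFunctor.IsEquivalence := { }
  exact ⟨hσ.gal, ⟨(CategoricalGalois.splitComparison adj σ ⋙ hσ.galFunctor).asEquivalence⟩⟩
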